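/- Let $M$ be a smooth $m$-dimensional manifold and let $\pi:Q\to\mathbb R$ be a smooth fibre bundle with typical fibre $M$ over the time axis $\mathbb R$ with its Cartesian coordinate $t$ (manifolds are Hausdorff and second countable, smooth means $C^\infty$). Bundle coordinates on $Q$ are local coordinates $(q^\lambda)=(q^0=t,q^1,\dots,q^m)$ with $t=\pi$; Greek indices run over $0,\dots,m$, Latin ones over $1,\dots,m$, and repeated indices are summed. Identify the first order jet manifold $J^1Q$, with coordinates $(t,q^i,q^i_t)$, with the submanifold $\dot t=1$, $\dot q^i=q^i_t$ of $TQ$. A dynamic equation on $Q$ is a holonomic connection $$\xi=\partial_t+q^i_t\,\partial_i+\xi^i(t,q^j,q^j_t)\,\partial^t_i$$ on $J^1Q\to\mathbb R$, i.e. a second order equation $q^i_{tt}=\xi^i(t,q^j,q^j_t)$. A reference frame is a connection on $Q\to\mathbb R$, i.e. a smooth vector field $\Gamma$ on $Q$ with $dt(\Gamma)=1$; bundle coordinates $(t,\overline q^i)$ are proper for $\Gamma$ if $\Gamma=\partial_t$ in them. The dynamic equation $\xi$ is called a free motion equation if there are a reference frame $\Gamma$ and an atlas of bundle coordinates $(t,\overline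 q^i)$ proper for $\Gamma$ in which the equation reads $\overline q^i_{tt}=0$. If $\xi$ is a free motion equation on $Q$, then: 1. $\xi$ is quadratic: in all bundle coordinates, $$\xi^i=a^i_{jk}(q^\mu)\,q^j_tq^k_t+b^i_j(q^\mu)\,q^j_t+f^i(q^\mu)$$ with smooth functions $a^i_{jk}=a^i_{kj}$, $b^i_j$, $f^i$; 2. there is a unique linear connection $K=dq^\lambda\otimes(\partial_\lambda+K_\lambda{}^\mu{}_\nu\,\dot q^\nu\,\dot\partial_\mu)$ on $TQ\to Q$ which in all bundle coordinates has the components $$K_\lambda{}^0{}_\nu=0,\qquad K_0{}^i{}_0=f^i,\qquad K_0{}^i{}_j=K_j{}^i{}_0=\tfrac12 b^i_j,\qquad K_k{}^i{}_j=a^i_{kj},$$ and this connection is smooth, symmetric (torsion-free) and curvature-free. -/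

import Mathlib

open scoped Manifold ContDiff Topology

noncomputable section

namespace TimeMechanics

section Bundle

variable {m : ℕ} {Q : Type*} [TopologicalSpace Q] [ChartedSpace (EuclideanSpace ℝ (Fin (m + 1))) Q]

/-- `π : Q → ℝ` is a smooth fibre bundle over the time axis with typical fibre `M`: the projection
is smooth, and around every instant there is a local trivialization
`π⁻¹(U) ≅ U × M` over `U` which is a diffeomorphism. -/
structure IsSmoothFibreBundle (m : ℕ) {Q : Type*} [TopologicalSpace Q]
    [ChartedSpace (EuclideanSpace ℝ (Fin (m + 1))) Q] (M : Type*) [TopologicalSpace M]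
    [ChartedSpace (EuclideanSpace ℝ (Fin m)) M] (π : Q → ℝ) : Prop where
  contMDiff_proj : ContMDiff (𝓡 (m + 1)) 𝓘(ℝ, ℝ) ∞ π
  exists_trivialization : ∀ t : ℝ, ∃ e : Bundle.Trivialization M π, t ∈ e.baseSet ∧
    ContMDiffOn (𝓡 (m + 1)) (𝓘(ℝ, ℝ).prod (𝓡 m)) ∞ e e.source ∧
    ContMDiffOn (𝓘(ℝ, ℝ).prod (𝓡 m)) (𝓡 (m + 1)) ∞ e.toOpenPartialHomeomorph.symm e.target

/-- Bundle coordinates `(t, q¹, …, qᵐ)` on `π : Q → ℝ`: a smooth chart of `Q` whose zeroth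
coordinate is the time `t = π`. -/
structure IsBundleChart (π : Q → ℝ)
    (φ : OpenPartialHomeomorph Q (EuclideanSpace ℝ (Fin (m + 1)))) : Prop where
  mem_maximalAtlas : φ ∈ IsManifold.maximalAtlas (𝓡 (m + 1)) ∞ Q
  time_coord : ∀ q ∈ φ.source, φ q 0 = π q

/-- The induced fibre coordinates `(q̇⁰, …, q̇ᵐ)` of a tangent vector `v` at `q`, with respect to
the coordinates `φ` on `Q`; here `q̇⁰ = ṫ` if `φ` is a bundle chart. -/
def velocity (φ : OpenPartialHomeomorph Q (EuclideanSpace ℝ (Fin (m + 1)))) (q : Q)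
    (v : TangentSpace (𝓡 (m + 1)) q) : EuclideanSpace ℝ (Fin (m + 1)) :=
  mfderiv (𝓡 (m + 1)) 𝓘(ℝ, EuclideanSpace ℝ (Fin (m + 1))) φ q v

/-- The function `ṫ = dt` on the tangent bundle `TQ`. -/
def timeRate (π : Q → ℝ) (v : TangentBundle (𝓡 (m + 1)) Q) : ℝ :=
  mfderiv (𝓡 (m + 1)) 𝓘(ℝ, ℝ) π v.proj v.2

/-- The first order jet manifold `J¹Q` of `π : Q → ℝ`, identified with its image under the canonical
imbedding `(t, qⁱ, qⁱₜ) ↦ (t, qⁱ, ṫ = 1, q̇ⁱ = qⁱₜ)` in `TQ`. -/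
def jetOne (π : Q → ℝ) : Set (TangentBundle (𝓡 (m + 1)) Q) :=
  {v | timeRate π v = 1}

end Bundle

section Equation

variable {m : ℕ} {Q : Type*} [TopologicalSpace Q] [ChartedSpace (EuclideanSpace ℝ (Fin (m + 1))) Q]
  [IsManifold (𝓡 (m + 1)) ∞ Q]

/-- A dynamic equation on `π : Q → ℝ`: a holonomic connection
`ξ = ∂ₜ + qⁱₜ ∂ᵢ + ξⁱ(t, q, qₜ) ∂ᵢᵗ` on `J¹Q → ℝ`, that is, a smooth vector field on `J¹Q ⊆ TQ` (the
field `tangent` says that it is tangent to the submanifold `ṫ = 1`) with values in `J²Q`, which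
means that it projects at `v ∈ J¹Q` to `v` itself. The values of `toFun` off `J¹Q` are
irrelevant. -/
structure DynamicEquation (m : ℕ) {Q : Type*} [TopologicalSpace Q]
    [ChartedSpace (EuclideanSpace ℝ (Fin (m + 1))) Q] [IsManifold (𝓡 (m + 1)) ∞ Q]
    (π : Q → ℝ) where
  toFun : ∀ v : TangentBundle (𝓡 (m + 1)) Q, TangentSpace (𝓡 (m + 1)).tangent v
  holonomic : ∀ v ∈ jetOne π,
    mfderiv (𝓡 (m + 1)).tangent (𝓡 (m + 1))
      (fun w : TangentBundle (𝓡 (m + 1)) Q => w.proj) v (toFun v) = v.2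
  tangent : ∀ v ∈ jetOne π,
    mfderiv (𝓡 (m + 1)).tangent 𝓘(ℝ, ℝ) (timeRate π) v (toFun v) = 0
  smooth : ContMDiffOn (𝓡 (m + 1)).tangent (𝓡 (m + 1)).tangent.tangent ∞
    (fun v => (⟨v, toFun v⟩ :
      TangentBundle (𝓡 (m + 1)).tangent (TangentBundle (𝓡 (m + 1)) Q))) (jetOne π)

/-- The component `ξⁱ` at `v ∈ J¹Q` of a dynamic equation in the bundle coordinates `φ`: the derivative
of the function `q̇ⁱ` on `TQ` along `ξ`. The equation reads `qⁱₜₜ = ξⁱ(t, q, qₜ)`. -/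
def DynamicEquation.component {π : Q → ℝ} (ξ : DynamicEquation m π)
    (φ : OpenPartialHomeomorph Q (EuclideanSpace ℝ (Fin (m + 1))))
    (v : TangentBundle (𝓡 (m + 1)) Q) (i : Fin m) : ℝ :=
  (show EuclideanSpace ℝ (Fin (m + 1)) from
    mfderiv (𝓡 (m + 1)).tangent 𝓘(ℝ, EuclideanSpace ℝ (Fin (m + 1)))
      (fun w : TangentBundle (𝓡 (m + 1)) Q => velocity φ w.proj w.2) v (ξ.toFun v)) i.succ

/-- A reference frame on `π : Q → ℝ`: a connection `Γ` on this bundle, that is, a smooth vector field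
`Γ` on `Q` with `dt(Γ) = 1`. -/
structure ReferenceFrame (m : ℕ) {Q : Type*} [TopologicalSpace Q]
    [ChartedSpace (EuclideanSpace ℝ (Fin (m + 1))) Q] [IsManifold (𝓡 (m + 1)) ∞ Q]
    (π : Q → ℝ) where
  toFun : ∀ q : Q, TangentSpace (𝓡 (m + 1)) q
  smooth : ContMDiff (𝓡 (m + 1)) (𝓡 (m + 1)).tangent ∞
    (fun q => (⟨q, toFun q⟩ : TangentBundle (𝓡 (m + 1)) Q))
  time_rate : ∀ q : Q, timeRate π ⟨q, toFun q⟩ = 1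

/-- The bundle coordinates `φ` are proper for the reference frame `Γ`: in them `Γ = ∂ₜ`. -/
def ReferenceFrame.IsProperChart {π : Q → ℝ} (Γ : ReferenceFrame m π)
    (φ : OpenPartialHomeomorph Q (EuclideanSpace ℝ (Fin (m + 1)))) : Prop :=
  IsBundleChart π φ ∧
    ∀ q ∈ φ.source, velocity φ q (Γ.toFun q) = EuclideanSpace.single 0 1

/-- `ξ` is a free motion equation: there are a reference frame and an atlas of bundle coordinates
`(t, q̄ⁱ)` proper for it, with respect to all of which the equation reads `q̄ⁱₜₜ = 0`. -/
def DynamicEquation.IsFreeMotion {π : Q → ℝ} (ξ : DynamicEquation m π) : Prop :=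
  ∃ Γ : ReferenceFrame m π, ∀ q : Q,
    ∃ φ : OpenPartialHomeomorph Q (EuclideanSpace ℝ (Fin (m + 1))),
      q ∈ φ.source ∧ Γ.IsProperChart φ ∧
      ∀ v ∈ jetOne π, v.proj ∈ φ.source → ∀ i, ξ.component φ v i = 0

/-- In the bundle coordinates `φ` the equation is quadratic with smooth coefficient functions
`a i j k = a k j` (symmetric), `b i j` and `f i`:
`ξⁱ = aⁱⱼₖ(q) qʲₜ qᵏₜ + bⁱⱼ(q) qʲₜ + fⁱ(q)`. -/
structure DynamicEquation.HasQuadraticForm {π : Q → ℝ} (ξ : DynamicEquation m π)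
    (φ : OpenPartialHomeomorph Q (EuclideanSpace ℝ (Fin (m + 1))))
    (a : Fin m → Fin m → Fin m → Q → ℝ) (b : Fin m → Fin m → Q → ℝ) (f : Fin m → Q → ℝ) :
    Prop where
  symm : ∀ i j k, ∀ q ∈ φ.source, a i j k q = a i k j q
  smooth_a : ∀ i j k, ContMDiffOn (𝓡 (m + 1)) 𝓘(ℝ, ℝ) ∞ (a i j k) φ.source
  smooth_b : ∀ i j, ContMDiffOn (𝓡 (m + 1)) 𝓘(ℝ, ℝ) ∞ (b i j) φ.source
  smooth_f : ∀ i, ContMDiffOn (𝓡 (m + 1)) 𝓘(ℝ, ℝ) ∞ (f i) φ.source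
  component_eq : ∀ v ∈ jetOne π, v.proj ∈ φ.source → ∀ i, ξ.component φ v i =
    (∑ j, ∑ k, a i j k v.proj * velocity φ v.proj v.2 j.succ * velocity φ v.proj v.2 k.succ) +
      (∑ j, b i j v.proj * velocity φ v.proj v.2 j.succ) + f i v.proj

/-- `ξ` is a quadratic dynamic equation: it is quadratic in the velocities in all bundle
coordinates. -/
def DynamicEquation.IsQuadratic {π : Q → ℝ} (ξ : DynamicEquation m π) : Prop :=
  ∀ φ, IsBundleChart π φ → ∃ a b f, ξ.HasQuadraticForm φ a b f

end Equation

section Connection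

variable {m : ℕ} {Q : Type*} [TopologicalSpace Q] [ChartedSpace (EuclideanSpace ℝ (Fin (m + 1))) Q]
  [IsManifold (𝓡 (m + 1)) ∞ Q]

/-- A linear connection on the vector bundle `TQ → Q`, given by its covariant derivative: `K Z q v` is
`∇_v Z` at `q`. -/
abbrev LinearConnection (m : ℕ) (Q : Type*) [TopologicalSpace Q]
    [ChartedSpace (EuclideanSpace ℝ (Fin (m + 1))) Q] [IsManifold (𝓡 (m + 1)) ∞ Q] :=
  CovariantDerivative (𝓡 (m + 1)) (EuclideanSpace ℝ (Fin (m + 1)))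
    (TangentSpace (𝓡 (m + 1)) : Q → Type _)

/-- The linear connection `K = dq^λ ⊗ (∂_λ + K_λ^μ_ν q̇^ν ∂̇_μ)` has the components
`k l μ ν = K_l^μ_ν` in the coordinates `φ`. In terms of the covariant derivative,
`(∇_v Z)^μ = v(Z^μ) - K_l^μ_ν v^l Z^ν` for all vector fields `Z` differentiable at the point. -/
def LinearConnection.HasComponents (K : LinearConnection m Q)
    (φ : OpenPartialHomeomorph Q (EuclideanSpace ℝ (Fin (m + 1))))
    (k : Fin (m + 1) → Fin (m + 1) → Fin (m + 1) → Q → ℝ) : Prop :=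
  ∀ q ∈ φ.source, ∀ Z : ∀ p : Q, TangentSpace (𝓡 (m + 1)) p,
    MDifferentiableAt (𝓡 (m + 1)) (𝓡 (m + 1)).tangent
      (fun p => (⟨p, Z p⟩ : TangentBundle (𝓡 (m + 1)) Q)) q →
    ∀ (v : TangentSpace (𝓡 (m + 1)) q) (μ : Fin (m + 1)),
      velocity φ q (K Z q v) μ =
        (show ℝ from mfderiv (𝓡 (m + 1)) 𝓘(ℝ, ℝ) (fun p => velocity φ p (Z p) μ) q v) -
          ∑ l, ∑ ν, k l μ ν q * velocity φ q v l * velocity φ q (Z q) ν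

/-- The components `K_l^0_ν = 0`, `K_0^i_0 = fⁱ`, `K_0^i_j = K_j^i_0 = ½ bⁱⱼ`, `K_k^i_j = aⁱₖⱼ`
built from the coefficients of a quadratic equation. -/
def quadraticComponents (a : Fin m → Fin m → Fin m → Q → ℝ) (b : Fin m → Fin m → Q → ℝ)
    (f : Fin m → Q → ℝ) (l μ ν : Fin (m + 1)) (q : Q) : ℝ :=
  Fin.cases 0
    (fun i => Fin.cases
      (Fin.cases (f i q) (fun j => (1 / 2) * b i j q) ν)
      (fun k => Fin.cases ((1 / 2) * b i k q) (fun j => a i k j q) ν) l) μ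

/-- `K` is the linear connection on `TQ → Q` corresponding to the quadratic dynamic equation `ξ`. -/
def LinearConnection.CorrespondsTo (K : LinearConnection m Q) {π : Q → ℝ}
    (ξ : DynamicEquation m π) : Prop :=
  ∀ φ, IsBundleChart π φ → ∃ a b f, ξ.HasQuadraticForm φ a b f ∧
    K.HasComponents φ (quadraticComponents a b f)

/-- The curvature `R(X, Y) Z = ∇_X ∇_Y Z - ∇_Y ∇_X Z - ∇_[X, Y] Z` at `q`. -/
def LinearConnection.curvature (K : LinearConnection m Q)
    (X Y Z : ∀ p : Q, TangentSpace (𝓡 (m + 1)) p) (q : Q) : TangentSpace (𝓡 (m + 1)) q :=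
  K (fun p => K Z p (Y p)) q (X q) - K (fun p => K Z p (X p)) q (Y q) -
    K Z q (VectorField.mlieBracket (𝓡 (m + 1)) X Y q)

/-- The connection is curvature-free: `R(X, Y) Z = 0` at every point `q` for all vector fields that are
smooth at `q`. -/
def LinearConnection.IsCurvatureFree (K : LinearConnection m Q) : Prop :=
  ∀ (q : Q) (X Y Z : ∀ p : Q, TangentSpace (𝓡 (m + 1)) p),
    ContMDiffAt (𝓡 (m + 1)) (𝓡 (m + 1)).tangent ∞
      (fun p => (⟨p, X p⟩ : TangentBundle (𝓡 (m + 1)) Q)) q →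
    ContMDiffAt (𝓡 (m + 1)) (𝓡 (m + 1)).tangent ∞
      (fun p => (⟨p, Y p⟩ : TangentBundle (𝓡 (m + 1)) Q)) q →
    ContMDiffAt (𝓡 (m + 1)) (𝓡 (m + 1)).tangent ∞
      (fun p => (⟨p, Z p⟩ : TangentBundle (𝓡 (m + 1)) Q)) q →
    K.curvature X Y Z q = 0

/-- Two covariant derivatives represent the same linear connection: they agree on every
vector field at every point where the field is differentiable (elsewhere a covariant derivative takes
arbitrary values). -/
def LinearConnection.SameAs (K K' : LinearConnection m Q) : Prop :=
  ∀ (q : Q) (Z : ∀ p : Q, TangentSpace (𝓡 (m + 1)) p),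
    MDifferentiableAt (𝓡 (m + 1)) (𝓡 (m + 1)).tangent
      (fun p => (⟨p, Z p⟩ : TangentBundle (𝓡 (m + 1)) Q)) q →
    K Z q = K' Z q

end Connection

end TimeMechanics

end

/-
On the affine hyperplane `u⁰ = 1` of velocities, a symmetric bilinear map is determined by its
diagonal. Hence the transition between two charts in which the equation reads `qⁱₜₜ = 0` has
vanishing second derivative: the chain rule gives `D²T(u, u) = 0` for `u⁰ = 1`. Such charts
therefore form an affine atlas, and differentiating the components of vector fields in them gives
a well-defined connection `K`. In these charts its smoothness is clear, and its torsion and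
curvature vanish by the symmetry of second derivatives. In arbitrary bundle coordinates the
components of `K` and the coefficients of the equation are both read off from the second
derivative of the transition to a free chart. Uniqueness is the hyperplane principle again: a
quadratic equation determines the symmetric components with `K_l^0_ν = 0` that represent it.
-/

noncomputable section

namespace TimeMechanics

section Polarization

variable {k V F : Type*} [Field k] [NeZero (2 : k)] [AddCommGroup V] [Module k V]
  [AddCommGroup F] [Module k F] {B : LinearMap.BilinMap k V F} {ℓ : V →ₗ[k] k} {e : V}

theorem bilin_self_eq_zero_of_affineHyperplane (he : ℓ e = 1) (h : ∀ u, ℓ u = 1 → B u u = 0)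
    (u : V) : B u u = 0 := by
  by_cases hu : ℓ u = 0
  · have hadd : B (e + u) (e + u) = 0 := h _ (by simp [he, hu])
    have hsub : B (e - u) (e - u) = 0 := h _ (by simp [he, hu])
    have parallelogram : (2 : k) • B u u =
        B (e + u) (e + u) + B (e - u) (e - u) - (2 : k) • B e e := by
      simp only [map_add, map_sub, LinearMap.add_apply, LinearMap.sub_apply]
      module
    rw [hadd, hsub, h e he, smul_zero, add_zero, sub_zero] at parallelogram
    exact (smul_eq_zero.mp parallelogram).resolve_left two_ne_zero
  · have hscale : B ((ℓ u)⁻¹ • u) ((ℓ u)⁻¹ • u) = 0 := h _ (by simp [hu])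
    simpa [hu] using hscale

theorem bilin_eq_zero_of_affineHyperplane (hB : ∀ u w, B u w = B w u) (he : ℓ e = 1)
    (h : ∀ u, ℓ u = 1 → B u u = 0) : B = 0 := by
  have hself := bilin_self_eq_zero_of_affineHyperplane he h
  ext u w
  have hpolar : (2 : k) • B u w = B (u + w) (u + w) - B u u - B w w := by
    simp only [map_add, LinearMap.add_apply, hB w u]
    module
  simp only [hself, sub_zero] at hpolar
  exact (smul_eq_zero.mp hpolar).resolve_left two_ne_zero

theorem matrix_eq_of_affineHyperplane {ι : Type*} [Fintype ι] {i₀ : ι}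
    {A A' : Matrix ι ι k} (hA : A.IsSymm) (hA' : A'.IsSymm)
    (h : ∀ u : ι → k, u i₀ = 1 →
      ∑ i, ∑ j, A i j * u i * u j = ∑ i, ∑ j, A' i j * u i * u j) : A = A' := by
  classical
  have happly (D : Matrix ι ι k) (u w : ι → k) :
      Matrix.toBilin' D u w = ∑ i, ∑ j, D i j * u i * w j := by
    simp only [Matrix.toBilin'_apply, mul_comm (u _)]
  have hsymm : (A - A').IsSymm := hA.sub hA'
  refine sub_eq_zero.mp (Matrix.toBilin'.map_eq_zero_iff.mp
    (bilin_eq_zero_of_affineHyperplane (ℓ := LinearMap.proj i₀) (e := Pi.single i₀ 1)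
      (fun u w ↦ ?_) (by simp) fun u hu ↦ ?_))
  · rw [happly, happly, Finset.sum_comm]
    simp only [hsymm.apply, mul_right_comm]
  · rw [map_sub, LinearMap.sub_apply, LinearMap.sub_apply, happly, happly, h u hu, sub_self]

end Polarization

section Charts

variable {m : ℕ} {Q : Type*} [TopologicalSpace Q] [ChartedSpace (EuclideanSpace ℝ (Fin (m + 1))) Q]

/-- The coordinate space `ℝ × ℝᵐ` in which the charts of `Q` take their values. -/
abbrev CoordSpace (m : ℕ) := EuclideanSpace ℝ (Fin (m + 1))

/-- The coordinate change from `φ` to `ψ`, with junk values off the image under `φ` of the common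
domain. -/
def transition (φ ψ : OpenPartialHomeomorph Q (CoordSpace m)) : CoordSpace m → CoordSpace m :=
  ψ ∘ φ.symm

/-- The vector field `Z` read in the coordinates `φ`. -/
def coordField (φ : OpenPartialHomeomorph Q (CoordSpace m))
    (Z : ∀ p : Q, TangentSpace (𝓡 (m + 1)) p) (x : CoordSpace m) : CoordSpace m :=
  velocity φ (φ.symm x) (Z (φ.symm x))

variable {φ ψ : OpenPartialHomeomorph Q (CoordSpace m)} {q : Q}

theorem mdifferentiable_of_mem_maximalAtlas (hφ : φ ∈ IsManifold.maximalAtlas (𝓡 (m + 1)) ∞ Q) :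
    φ.MDifferentiable (𝓡 (m + 1)) (𝓡 (m + 1)) :=
  ⟨(contMDiffOn_of_mem_maximalAtlas hφ).mdifferentiableOn (by simp),
    (contMDiffOn_symm_of_mem_maximalAtlas hφ).mdifferentiableOn (by simp)⟩

/-- The fibre coordinates of tangent vectors at `q` as a linear isomorphism. -/
def velocityEquiv (hφ : φ ∈ IsManifold.maximalAtlas (𝓡 (m + 1)) ∞ Q) (hq : q ∈ φ.source) :
    TangentSpace (𝓡 (m + 1)) q ≃L[ℝ] CoordSpace m :=
  (mdifferentiable_of_mem_maximalAtlas hφ).mfderiv hq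

@[simp]
theorem velocityEquiv_apply (hφ : φ ∈ IsManifold.maximalAtlas (𝓡 (m + 1)) ∞ Q) (hq : q ∈ φ.source)
    (v : TangentSpace (𝓡 (m + 1)) q) : velocityEquiv hφ hq v = velocity φ q v :=
  rfl

theorem velocity_injective (hφ : φ ∈ IsManifold.maximalAtlas (𝓡 (m + 1)) ∞ Q)
    (hq : q ∈ φ.source) : Function.Injective (velocity φ q) :=
  (velocityEquiv hφ hq).injective

theorem velocity_surjective (hφ : φ ∈ IsManifold.maximalAtlas (𝓡 (m + 1)) ∞ Q)
    (hq : q ∈ φ.source) : Function.Surjective (velocity φ q) :=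
  (velocityEquiv hφ hq).surjective

theorem contDiffAt_comp_symm {F : Type*} [NormedAddCommGroup F] [NormedSpace ℝ F] {f : Q → F}
    (hφ : φ ∈ IsManifold.maximalAtlas (𝓡 (m + 1)) ∞ Q) (hq : q ∈ φ.source)
    (hf : ContMDiffAt (𝓡 (m + 1)) 𝓘(ℝ, F) ∞ f q) : ContDiffAt ℝ ∞ (f ∘ φ.symm) (φ q) := by
  rw [← contMDiffAt_iff_contDiffAt]
  rw [← φ.left_inv hq] at hf
  exact hf.comp (φ q) (contMDiffAt_symm_of_mem_maximalAtlas hφ (φ.map_source hq))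

theorem differentiableAt_comp_symm {F : Type*} [NormedAddCommGroup F] [NormedSpace ℝ F] {f : Q → F}
    (hφ : φ ∈ IsManifold.maximalAtlas (𝓡 (m + 1)) ∞ Q) (hq : q ∈ φ.source)
    (hf : MDifferentiableAt (𝓡 (m + 1)) 𝓘(ℝ, F) f q) :
    DifferentiableAt ℝ (f ∘ φ.symm) (φ q) := by
  rw [← mdifferentiableAt_iff_differentiableAt]
  rw [← φ.left_inv hq] at hf
  exact hf.comp (φ q)
    ((mdifferentiable_of_mem_maximalAtlas hφ).mdifferentiableAt_symm (φ.map_source hq))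

theorem mvfderiv_apply_eq_fderiv_comp_symm {F : Type*} [NormedAddCommGroup F] [NormedSpace ℝ F]
    {f : Q → F} (hφ : φ ∈ IsManifold.maximalAtlas (𝓡 (m + 1)) ∞ Q) (hq : q ∈ φ.source)
    (hf : MDifferentiableAt (𝓡 (m + 1)) 𝓘(ℝ, F) f q)
    (v : TangentSpace (𝓡 (m + 1)) q) :
    mvfderiv (𝓡 (m + 1)) f q v = fderiv ℝ (f ∘ φ.symm) (φ q) (velocity φ q v) := by
  have hφd := (mdifferentiable_of_mem_maximalAtlas hφ).mdifferentiableAt hq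
  have hchain := ((differentiableAt_comp_symm hφ hq hf).hasFDerivAt.hasMFDerivAt.comp q
    hφd.hasMFDerivAt).congr_of_eventuallyEq (f₁ := f) (by
      filter_upwards [φ.open_source.mem_nhds hq] with p hp
      simp only [Function.comp_apply, φ.left_inv hp])
  exact congrArg (fun L : TangentSpace (𝓡 (m + 1)) q →L[ℝ] F ↦ L v) hchain.mfderiv

theorem contDiffAt_transition (hφ : φ ∈ IsManifold.maximalAtlas (𝓡 (m + 1)) ∞ Q)
    (hψ : ψ ∈ IsManifold.maximalAtlas (𝓡 (m + 1)) ∞ Q) (hqφ : q ∈ φ.source)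
    (hqψ : q ∈ ψ.source) : ContDiffAt ℝ ∞ (transition φ ψ) (φ q) :=
  contDiffAt_comp_symm hφ hqφ (contMDiffAt_of_mem_maximalAtlas hψ hqψ)

theorem velocity_eq_fderiv_transition (hφ : φ ∈ IsManifold.maximalAtlas (𝓡 (m + 1)) ∞ Q)
    (hψ : ψ ∈ IsManifold.maximalAtlas (𝓡 (m + 1)) ∞ Q) (hqφ : q ∈ φ.source)
    (hqψ : q ∈ ψ.source) (v : TangentSpace (𝓡 (m + 1)) q) :
    velocity ψ q v = fderiv ℝ (transition φ ψ) (φ q) (velocity φ q v) :=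
  mvfderiv_apply_eq_fderiv_comp_symm hφ hqφ
    ((mdifferentiable_of_mem_maximalAtlas hψ).mdifferentiableAt hqψ) v

theorem fderiv_transition_fderiv_transition
    (hφ : φ ∈ IsManifold.maximalAtlas (𝓡 (m + 1)) ∞ Q)
    (hψ : ψ ∈ IsManifold.maximalAtlas (𝓡 (m + 1)) ∞ Q) (hqφ : q ∈ φ.source)
    (hqψ : q ∈ ψ.source) (u : CoordSpace m) :
    fderiv ℝ (transition ψ φ) (ψ q) (fderiv ℝ (transition φ ψ) (φ q) u) = u := by
  obtain ⟨v, rfl⟩ := velocity_surjective hφ hqφ u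
  rw [← velocity_eq_fderiv_transition hφ hψ hqφ hqψ,
    ← velocity_eq_fderiv_transition hψ hφ hqψ hqφ]

theorem sndFDeriv_transition_comm (hφ : φ ∈ IsManifold.maximalAtlas (𝓡 (m + 1)) ∞ Q)
    (hψ : ψ ∈ IsManifold.maximalAtlas (𝓡 (m + 1)) ∞ Q) (hqφ : q ∈ φ.source)
    (hqψ : q ∈ ψ.source) (u w : CoordSpace m) :
    fderiv ℝ (fderiv ℝ (transition φ ψ)) (φ q) u w =
      fderiv ℝ (fderiv ℝ (transition φ ψ)) (φ q) w u :=
  ((contDiffAt_transition hφ hψ hqφ hqψ).isSymmSndFDerivAt (by simp; norm_cast)).eq u w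

theorem contMDiffAt_fderiv_transition (hφ : φ ∈ IsManifold.maximalAtlas (𝓡 (m + 1)) ∞ Q)
    (hψ : ψ ∈ IsManifold.maximalAtlas (𝓡 (m + 1)) ∞ Q) (hqφ : q ∈ φ.source)
    (hqψ : q ∈ ψ.source) :
    ContMDiffAt (𝓡 (m + 1)) 𝓘(ℝ, CoordSpace m →L[ℝ] CoordSpace m) ∞
      (fun p ↦ fderiv ℝ (transition φ ψ) (φ p)) q :=
  ((contDiffAt_transition hφ hψ hqφ hqψ).fderiv_right (m := ∞) (by simp)).contMDiffAt.comp q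
    (contMDiffAt_of_mem_maximalAtlas hφ hqφ)

variable [IsManifold (𝓡 (m + 1)) ∞ Q]

theorem eventually_proj_mem_source {v : TangentBundle (𝓡 (m + 1)) Q} (hv : v.proj ∈ φ.source) :
    ∀ᶠ w : TangentBundle (𝓡 (m + 1)) Q in 𝓝 v, w.proj ∈ φ.source :=
  (FiberBundle.continuous_proj (CoordSpace m) (TangentSpace (𝓡 (m + 1)))).continuousAt.eventually
    (φ.open_source.mem_nhds hv)

theorem contMDiffAt_velocity (hφ : φ ∈ IsManifold.maximalAtlas (𝓡 (m + 1)) ∞ Q)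
    {v : TangentBundle (𝓡 (m + 1)) Q} (hv : v.proj ∈ φ.source) :
    ContMDiffAt (𝓡 (m + 1)).tangent 𝓘(ℝ, CoordSpace m) ∞
      (fun w : TangentBundle (𝓡 (m + 1)) Q ↦ velocity φ w.proj w.2) v := by
  have htangentMap := ((contMDiffOn_of_mem_maximalAtlas hφ).contMDiffOn_tangentMapWithin (m := ∞)
    (by simp) φ.open_source.uniqueMDiffOn).contMDiffAt (eventually_proj_mem_source hv)
  refine ((contMDiff_snd_tangentBundle_modelSpace (CoordSpace m)
    (𝓡 (m + 1))).contMDiffAt.comp v htangentMap).congr_of_eventuallyEq ?_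
  filter_upwards [eventually_proj_mem_source hv] with w hw
  simp only [Function.comp, tangentMapWithin]
  rw [mfderivWithin_of_isOpen φ.open_source hw]
  rfl

end Charts

section SecondOrder

variable {m : ℕ} {Q : Type*} [TopologicalSpace Q] [ChartedSpace (EuclideanSpace ℝ (Fin (m + 1))) Q]
  [IsManifold (𝓡 (m + 1)) ∞ Q] {φ ψ : OpenPartialHomeomorph Q (CoordSpace m)}
  {E' : Type*} [NormedAddCommGroup E'] [NormedSpace ℝ E'] {H' : Type*} [TopologicalSpace H']
  {J : ModelWithCorners ℝ E' H'} {N : Type*} [TopologicalSpace N] [ChartedSpace H' N]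
  {g : N → TangentBundle (𝓡 (m + 1)) Q} {n : N}

theorem mdifferentiableAt_velocity_comp (hφ : φ ∈ IsManifold.maximalAtlas (𝓡 (m + 1)) ∞ Q)
    (hg : MDifferentiableAt J (𝓡 (m + 1)).tangent g n) (hn : (g n).proj ∈ φ.source) :
    MDifferentiableAt J 𝓘(ℝ, CoordSpace m) (fun x ↦ velocity φ (g x).proj (g x).2) n :=
  ((contMDiffAt_velocity hφ hn).mdifferentiableAt (by simp)).comp n hg

theorem mdifferentiableAt_proj_comp (hg : MDifferentiableAt J (𝓡 (m + 1)).tangent g n) :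
    MDifferentiableAt J (𝓡 (m + 1)) (fun x ↦ (g x).proj) n :=
  ((Bundle.contMDiff_proj (TangentSpace (𝓡 (m + 1))) (n := 1)).contMDiffAt.mdifferentiableAt
    (by simp)).comp n hg

theorem mvfderiv_fderiv_velocity {F : Type*} [NormedAddCommGroup F] [NormedSpace ℝ F]
    {T : CoordSpace m → F} (hφ : φ ∈ IsManifold.maximalAtlas (𝓡 (m + 1)) ∞ Q)
    (hg : MDifferentiableAt J (𝓡 (m + 1)).tangent g n) (hn : (g n).proj ∈ φ.source)
    (hT : DifferentiableAt ℝ (fderiv ℝ T) (φ (g n).proj)) (ζ : TangentSpace J n) :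
    mvfderiv J (fun x ↦ fderiv ℝ T (φ (g x).proj) (velocity φ (g x).proj (g x).2)) n ζ =
      fderiv ℝ T (φ (g n).proj)
          (mvfderiv J (fun x ↦ velocity φ (g x).proj (g x).2) n ζ) +
        fderiv ℝ (fderiv ℝ T) (φ (g n).proj)
          (velocity φ (g n).proj (mfderiv J (𝓡 (m + 1)) (fun x ↦ (g x).proj) n ζ))
          (velocity φ (g n).proj (g n).2) := by
  have hproj : HasMFDerivAt J 𝓘(ℝ, CoordSpace m) (fun x ↦ φ (g x).proj) n _ :=
    ((mdifferentiable_of_mem_maximalAtlas hφ).mdifferentiableAt hn).hasMFDerivAt.comp n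
      (mdifferentiableAt_proj_comp hg).hasMFDerivAt
  have hvelocity := (mdifferentiableAt_velocity_comp hφ hg hn).hasMFDerivAt
  have hpair : HasMFDerivAt J 𝓘(ℝ, CoordSpace m × CoordSpace m)
      (fun x ↦ (φ (g x).proj, velocity φ (g x).proj (g x).2)) n _ :=
    ⟨hproj.1.prodMk hvelocity.1, hproj.2.prodMk hvelocity.2⟩
  have heval : HasFDerivAt (fun z : CoordSpace m × CoordSpace m ↦ fderiv ℝ T z.1 z.2) _
      (φ (g n).proj, velocity φ (g n).proj (g n).2) :=
    (hT.hasFDerivAt.comp (φ (g n).proj, velocity φ (g n).proj (g n).2) hasFDerivAt_fst).clm_apply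
      hasFDerivAt_snd
  exact congrArg (fun L : TangentSpace J n →L[ℝ] F ↦ L ζ)
    (heval.hasMFDerivAt.comp n hpair).mfderiv

theorem mvfderiv_velocity_transition (hφ : φ ∈ IsManifold.maximalAtlas (𝓡 (m + 1)) ∞ Q)
    (hψ : ψ ∈ IsManifold.maximalAtlas (𝓡 (m + 1)) ∞ Q)
    (hg : MDifferentiableAt J (𝓡 (m + 1)).tangent g n) (hnφ : (g n).proj ∈ φ.source)
    (hnψ : (g n).proj ∈ ψ.source) (ζ : TangentSpace J n) :
    mvfderiv J (fun x ↦ velocity ψ (g x).proj (g x).2) n ζ =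
      fderiv ℝ (transition φ ψ) (φ (g n).proj)
          (mvfderiv J (fun x ↦ velocity φ (g x).proj (g x).2) n ζ) +
        fderiv ℝ (fderiv ℝ (transition φ ψ)) (φ (g n).proj)
          (velocity φ (g n).proj (mfderiv J (𝓡 (m + 1)) (fun x ↦ (g x).proj) n ζ))
          (velocity φ (g n).proj (g n).2) := by
  have hT := (contDiffAt_transition hφ hψ hnφ hnψ).fderiv_right (m := 1) (by norm_cast)
  rw [← mvfderiv_fderiv_velocity hφ hg hnφ (hT.differentiableAt (by simp))]
  have hproj := (mdifferentiableAt_proj_comp hg).continuousAt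
  have hvelocity : (fun x ↦ velocity ψ (g x).proj (g x).2) =ᶠ[𝓝 n]
      fun x ↦ fderiv ℝ (transition φ ψ) (φ (g x).proj) (velocity φ (g x).proj (g x).2) := by
    filter_upwards [hproj.preimage_mem_nhds (φ.open_source.mem_nhds hnφ),
      hproj.preimage_mem_nhds (ψ.open_source.mem_nhds hnψ)] with x hxφ hxψ
    exact velocity_eq_fderiv_transition hφ hψ hxφ hxψ _
  exact congrArg (fun L : TangentSpace J n →L[ℝ] CoordSpace m ↦ L ζ) hvelocity.mfderiv_eq

end SecondOrder

section Fields

variable {m : ℕ} {Q : Type*} [TopologicalSpace Q] [ChartedSpace (EuclideanSpace ℝ (Fin (m + 1))) Q]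
  {φ ψ : OpenPartialHomeomorph Q (CoordSpace m)} {X Y Z : ∀ p : Q, TangentSpace (𝓡 (m + 1)) p}
  {q : Q}

theorem coordField_apply (hq : q ∈ φ.source) : coordField φ Z (φ q) = velocity φ q (Z q) := by
  rw [coordField, φ.left_inv hq]

theorem mpullback_symm_eq_coordField (hφ : φ ∈ IsManifold.maximalAtlas (𝓡 (m + 1)) ∞ Q)
    {x : CoordSpace m} (hx : x ∈ φ.target) :
    VectorField.mpullback (𝓡 (m + 1)) (𝓡 (m + 1)) φ.symm Z x = coordField φ Z x :=
  congrArg (fun L : TangentSpace (𝓡 (m + 1)) (φ.symm x) →L[ℝ] CoordSpace m ↦ L (Z (φ.symm x)))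
    (ContinuousLinearMap.inverse_equiv ((mdifferentiable_of_mem_maximalAtlas hφ).symm.mfderiv hx))

theorem mlieBracket_eq_lieBracket {E : Type*} [NormedAddCommGroup E] [NormedSpace ℝ E]
    (V W : ∀ x : E, TangentSpace 𝓘(ℝ, E) x) (x : E) :
    VectorField.mlieBracket 𝓘(ℝ, E) V W x = VectorField.lieBracket ℝ V W x := by
  rw [← VectorField.mlieBracketWithin_univ, VectorField.mlieBracketWithin_eq_lieBracketWithin]
  exact congrFun VectorField.lieBracketWithin_univ x

variable [IsManifold (𝓡 (m + 1)) ∞ Q]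

theorem contDiffAt_coordField (hφ : φ ∈ IsManifold.maximalAtlas (𝓡 (m + 1)) ∞ Q)
    (hq : q ∈ φ.source) (hZ : ContMDiffAt (𝓡 (m + 1)) (𝓡 (m + 1)).tangent ∞ (T% Z) q) :
    ContDiffAt ℝ ∞ (coordField φ Z) (φ q) :=
  contDiffAt_comp_symm hφ hq ((contMDiffAt_velocity hφ hq).comp q hZ)

theorem differentiableAt_coordField (hφ : φ ∈ IsManifold.maximalAtlas (𝓡 (m + 1)) ∞ Q)
    (hq : q ∈ φ.source)
    (hZ : MDifferentiableAt (𝓡 (m + 1)) (𝓡 (m + 1)).tangent (T% Z) q) :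
    DifferentiableAt ℝ (coordField φ Z) (φ q) :=
  differentiableAt_comp_symm hφ hq (mdifferentiableAt_velocity_comp hφ hZ hq)

theorem mvfderiv_velocity_eq_fderiv_coordField
    (hφ : φ ∈ IsManifold.maximalAtlas (𝓡 (m + 1)) ∞ Q) (hq : q ∈ φ.source)
    (hZ : MDifferentiableAt (𝓡 (m + 1)) (𝓡 (m + 1)).tangent (T% Z) q)
    (v : TangentSpace (𝓡 (m + 1)) q) :
    mvfderiv (𝓡 (m + 1)) (fun p ↦ velocity φ p (Z p)) q v =
      fderiv ℝ (coordField φ Z) (φ q) (velocity φ q v) :=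
  mvfderiv_apply_eq_fderiv_comp_symm hφ hq (mdifferentiableAt_velocity_comp hφ hZ hq) v

theorem mvfderiv_velocity_coord_eq_fderiv_coordField
    (hφ : φ ∈ IsManifold.maximalAtlas (𝓡 (m + 1)) ∞ Q) (hq : q ∈ φ.source)
    (hZ : MDifferentiableAt (𝓡 (m + 1)) (𝓡 (m + 1)).tangent (T% Z) q)
    (v : TangentSpace (𝓡 (m + 1)) q) (μ : Fin (m + 1)) :
    mvfderiv (𝓡 (m + 1)) (fun p ↦ velocity φ p (Z p) μ) q v =
      fderiv ℝ (coordField φ Z) (φ q) (velocity φ q v) μ := by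
  have hchain := (EuclideanSpace.proj μ : CoordSpace m →L[ℝ] ℝ).hasFDerivAt.hasMFDerivAt.comp q
    (mdifferentiableAt_velocity_comp hφ hZ hq).hasMFDerivAt
  rw [← mvfderiv_velocity_eq_fderiv_coordField hφ hq hZ]
  exact congrArg (fun L : TangentSpace (𝓡 (m + 1)) q →L[ℝ] ℝ ↦ L v) hchain.mfderiv

theorem fderiv_coordField_transition (hφ : φ ∈ IsManifold.maximalAtlas (𝓡 (m + 1)) ∞ Q)
    (hψ : ψ ∈ IsManifold.maximalAtlas (𝓡 (m + 1)) ∞ Q) (hqφ : q ∈ φ.source) (hqψ : q ∈ ψ.source)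
    (hZ : MDifferentiableAt (𝓡 (m + 1)) (𝓡 (m + 1)).tangent (T% Z) q)
    (v : TangentSpace (𝓡 (m + 1)) q) :
    fderiv ℝ (coordField ψ Z) (ψ q) (velocity ψ q v) =
      fderiv ℝ (transition φ ψ) (φ q) (fderiv ℝ (coordField φ Z) (φ q) (velocity φ q v)) +
        fderiv ℝ (fderiv ℝ (transition φ ψ)) (φ q) (velocity φ q v) (velocity φ q (Z q)) := by
  have htransition := mvfderiv_velocity_transition hφ hψ hZ hqφ hqψ v
  have hid : mfderiv (𝓡 (m + 1)) (𝓡 (m + 1)) (fun p : Q ↦ p) q = .id ℝ _ := mfderiv_id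
  rw [← mvfderiv_velocity_eq_fderiv_coordField hψ hqψ hZ,
    ← mvfderiv_velocity_eq_fderiv_coordField hφ hqφ hZ]
  simp only [hid] at htransition
  exact htransition

theorem velocity_mlieBracket (hφ : φ ∈ IsManifold.maximalAtlas (𝓡 (m + 1)) ∞ Q)
    (hq : q ∈ φ.source) (hX : MDifferentiableAt (𝓡 (m + 1)) (𝓡 (m + 1)).tangent (T% X) q)
    (hY : MDifferentiableAt (𝓡 (m + 1)) (𝓡 (m + 1)).tangent (T% Y) q) :
    velocity φ q (VectorField.mlieBracket (𝓡 (m + 1)) X Y q) =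
      VectorField.lieBracket ℝ (coordField φ X) (coordField φ Y) (φ q) := by
  have : IsManifold (𝓡 (m + 1)) (minSmoothness ℝ 2) Q := by
    rw [minSmoothness_of_isRCLikeNormedField]
    exact IsManifold.of_le (n := ∞) (by norm_cast)
  have hpullback (W : ∀ p : Q, TangentSpace (𝓡 (m + 1)) p) :
      VectorField.mpullback (𝓡 (m + 1)) (𝓡 (m + 1)) φ.symm W =ᶠ[𝓝 (φ q)] coordField φ W := by
    filter_upwards [φ.open_target.mem_nhds (φ.map_source hq)] with x hx
    exact mpullback_symm_eq_coordField hφ hx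
  refine Eq.trans ?_ (mlieBracket_eq_lieBracket (coordField φ X) (coordField φ Y) (φ q))
  rw [← (hpullback X).mlieBracket_vectorField_eq (hpullback Y),
    ← coordField_apply hq, ← mpullback_symm_eq_coordField hφ (φ.map_source hq)]
  exact VectorField.mpullback_mlieBracket (n := ∞) (by rwa [φ.left_inv hq])
    (by rwa [φ.left_inv hq]) (contMDiffAt_symm_of_mem_maximalAtlas hφ (φ.map_source hq))
    (by simp; norm_cast)

theorem eventually_mdifferentiableAt_section
    (hZ : ContMDiffAt (𝓡 (m + 1)) (𝓡 (m + 1)).tangent ∞ (T% Z) q) :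
    ∀ᶠ p in 𝓝 q, MDifferentiableAt (𝓡 (m + 1)) (𝓡 (m + 1)).tangent (T% Z) p := by
  filter_upwards [(contMDiffAt_iff_contMDiffAt_nhds (by simp)).mp
    (hZ.of_le (show (1 : ℕ∞ω) ≤ ∞ by norm_cast))] with p hp
  exact hp.mdifferentiableAt (by simp)

end Fields

section ConstFields

variable {m : ℕ} {Q : Type*} [TopologicalSpace Q] [ChartedSpace (EuclideanSpace ℝ (Fin (m + 1))) Q]
  {φ : OpenPartialHomeomorph Q (CoordSpace m)} {q : Q}

/-- The vector field with constant components `u` in the coordinates `φ`; it is the coordinate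
field `∂_ν` if `u` is the `ν`-th basis vector. -/
def constField (φ : OpenPartialHomeomorph Q (CoordSpace m)) (u : CoordSpace m) :
    ∀ p : Q, TangentSpace (𝓡 (m + 1)) p :=
  VectorField.mpullback (𝓡 (m + 1)) (𝓡 (m + 1)) φ fun _ ↦ u

theorem velocity_constField (hφ : φ ∈ IsManifold.maximalAtlas (𝓡 (m + 1)) ∞ Q)
    (hq : q ∈ φ.source) (u : CoordSpace m) : velocity φ q (constField φ u q) = u :=
  ContinuousLinearMap.IsInvertible.self_apply_inverse
    (f := mfderiv (𝓡 (m + 1)) (𝓡 (m + 1)) φ q) ⟨velocityEquiv hφ hq, rfl⟩ u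

theorem eventually_coordField_constField (hφ : φ ∈ IsManifold.maximalAtlas (𝓡 (m + 1)) ∞ Q)
    (hq : q ∈ φ.source) (u : CoordSpace m) :
    coordField φ (constField φ u) =ᶠ[𝓝 (φ q)] fun _ ↦ u := by
  filter_upwards [φ.open_target.mem_nhds (φ.map_source hq)] with x hx
  exact velocity_constField hφ (φ.map_target hx) u

theorem mdifferentiableAt_constField [IsManifold (𝓡 (m + 1)) ∞ Q]
    (hφ : φ ∈ IsManifold.maximalAtlas (𝓡 (m + 1)) ∞ Q) (hq : q ∈ φ.source) (u : CoordSpace m) :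
    MDifferentiableAt (𝓡 (m + 1)) (𝓡 (m + 1)).tangent (T% (constField φ u)) q := by
  have : IsManifold (𝓡 (m + 1)) 2 Q := IsManifold.of_le (n := ∞) (by norm_cast)
  refine MDifferentiableAt.mpullback_vectorField (n := ∞) ?_
    (contMDiffAt_of_mem_maximalAtlas hφ hq) ⟨velocityEquiv hφ hq, rfl⟩ (by norm_cast)
  exact contMDiffAt_vectorSpace_iff_contDiffAt (n := 1) |>.mpr contDiffAt_const
    |>.mdifferentiableAt (by simp)

end ConstFields

section FlatCharts

variable {m : ℕ} {Q : Type*} [TopologicalSpace Q]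
  {φ ψ : OpenPartialHomeomorph Q (CoordSpace m)} {q : Q}

/-- The components in the coordinates `φ` of the connection which is flat in the coordinates `ψ`,
as the bilinear map `(u, w) ↦ K_l^μ_ν uˡ w^ν`. -/
def christoffel (φ ψ : OpenPartialHomeomorph Q (CoordSpace m)) (q : Q) :
    CoordSpace m →L[ℝ] CoordSpace m →L[ℝ] CoordSpace m :=
  -(ContinuousLinearMap.compL ℝ (CoordSpace m) (CoordSpace m) (CoordSpace m)
    (fderiv ℝ (transition ψ φ) (ψ q)) ∘L fderiv ℝ (fderiv ℝ (transition φ ψ)) (φ q))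

theorem christoffel_apply (u w : CoordSpace m) : christoffel φ ψ q u w =
    -fderiv ℝ (transition ψ φ) (ψ q) (fderiv ℝ (fderiv ℝ (transition φ ψ)) (φ q) u w) :=
  rfl

theorem sum_christoffel_single (u w : CoordSpace m) (μ : Fin (m + 1)) :
    ∑ l, ∑ ν, christoffel φ ψ q (EuclideanSpace.single l 1) (EuclideanSpace.single ν 1) μ *
      u l * w ν = christoffel φ ψ q u w μ := by
  have hbasis (u : CoordSpace m) : ∑ l, u l • EuclideanSpace.single l (1 : ℝ) = u := by
    simpa using (EuclideanSpace.basisFun (Fin (m + 1)) ℝ).sum_repr u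
  conv_rhs => rw [← hbasis u, ← hbasis w]
  simp only [map_sum, map_smul, sum_apply, smul_apply,
    WithLp.ofLp_sum, Finset.sum_apply, PiLp.smul_apply, smul_eq_mul, Finset.mul_sum]
  rw [Finset.sum_comm]
  exact Finset.sum_congr rfl fun _ _ ↦ Finset.sum_congr rfl fun _ _ ↦ by ring

variable [ChartedSpace (EuclideanSpace ℝ (Fin (m + 1))) Q]

theorem christoffel_comm (hφ : φ ∈ IsManifold.maximalAtlas (𝓡 (m + 1)) ∞ Q)
    (hψ : ψ ∈ IsManifold.maximalAtlas (𝓡 (m + 1)) ∞ Q) (hqφ : q ∈ φ.source) (hqψ : q ∈ ψ.source)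
    (u w : CoordSpace m) : christoffel φ ψ q u w = christoffel φ ψ q w u := by
  rw [christoffel_apply, sndFDeriv_transition_comm hφ hψ hqφ hqψ, christoffel_apply]

theorem contMDiffAt_christoffel
    (hφ : φ ∈ IsManifold.maximalAtlas (𝓡 (m + 1)) ∞ Q)
    (hψ : ψ ∈ IsManifold.maximalAtlas (𝓡 (m + 1)) ∞ Q) (hqφ : q ∈ φ.source) (hqψ : q ∈ ψ.source)
    (u w : CoordSpace m) :
    ContMDiffAt (𝓡 (m + 1)) 𝓘(ℝ, CoordSpace m) ∞ (fun p ↦ christoffel φ ψ p u w) q := by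
  have hsnd : ContDiffAt ℝ ∞ (fderiv ℝ (fderiv ℝ (transition φ ψ))) (φ q) :=
    ((contDiffAt_transition hφ hψ hqφ hqψ).fderiv_right (m := ∞) (by simp)).fderiv_right
      (m := ∞) (by simp)
  have hpre : ContMDiffAt (𝓡 (m + 1)) 𝓘(ℝ, CoordSpace m →L[ℝ] CoordSpace m →L[ℝ] CoordSpace m) ∞
      (fun p ↦ fderiv ℝ (fderiv ℝ (transition φ ψ)) (φ p)) q :=
    hsnd.contMDiffAt.comp q (contMDiffAt_of_mem_maximalAtlas hφ hqφ)
  exact ((contMDiffAt_fderiv_transition hψ hφ hqψ hqφ).clm_apply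
    ((hpre.clm_apply contMDiffAt_const).clm_apply contMDiffAt_const)).neg

variable [IsManifold (𝓡 (m + 1)) ∞ Q] {K : LinearConnection m Q}
  {X Y Z : ∀ p : Q, TangentSpace (𝓡 (m + 1)) p}

/-- Coordinates `ψ` in which the components of the linear connection `K` vanish, so that the
covariant derivative is the ordinary derivative of the components of vector fields. -/
structure LinearConnection.IsFlatChart (K : LinearConnection m Q)
    (ψ : OpenPartialHomeomorph Q (CoordSpace m)) : Prop where
  mem_maximalAtlas : ψ ∈ IsManifold.maximalAtlas (𝓡 (m + 1)) ∞ Q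
  velocity_apply : ∀ q ∈ ψ.source, ∀ Z : ∀ p : Q, TangentSpace (𝓡 (m + 1)) p,
    MDifferentiableAt (𝓡 (m + 1)) (𝓡 (m + 1)).tangent (T% Z) q →
    ∀ v : TangentSpace (𝓡 (m + 1)) q,
      velocity ψ q (K Z q v) = fderiv ℝ (coordField ψ Z) (ψ q) (velocity ψ q v)

/-- The linear connection `K` admits flat coordinates around every point. -/
def LinearConnection.IsLocallyFlat (K : LinearConnection m Q) : Prop :=
  ∀ q : Q, ∃ ψ : OpenPartialHomeomorph Q (CoordSpace m), K.IsFlatChart ψ ∧ q ∈ ψ.source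

theorem LinearConnection.IsFlatChart.velocity_apply_eq_sub_christoffel (hψ : K.IsFlatChart ψ)
    (hφ : φ ∈ IsManifold.maximalAtlas (𝓡 (m + 1)) ∞ Q) (hqφ : q ∈ φ.source) (hqψ : q ∈ ψ.source)
    (hZ : MDifferentiableAt (𝓡 (m + 1)) (𝓡 (m + 1)).tangent (T% Z) q)
    (v : TangentSpace (𝓡 (m + 1)) q) :
    velocity φ q (K Z q v) = fderiv ℝ (coordField φ Z) (φ q) (velocity φ q v) -
      christoffel φ ψ q (velocity φ q v) (velocity φ q (Z q)) := by
  have hψm := hψ.mem_maximalAtlas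
  rw [velocity_eq_fderiv_transition hψm hφ hqψ hqφ, hψ.velocity_apply q hqψ Z hZ,
    fderiv_coordField_transition hφ hψm hqφ hqψ hZ, map_add,
    fderiv_transition_fderiv_transition hφ hψm hqφ hqψ, christoffel_apply, sub_neg_eq_add]

theorem LinearConnection.IsFlatChart.coordField_apply_eventuallyEq (hψ : K.IsFlatChart ψ)
    (hq : q ∈ ψ.source) (hZ : ContMDiffAt (𝓡 (m + 1)) (𝓡 (m + 1)).tangent ∞ (T% Z) q) :
    coordField ψ (fun p ↦ K Z p (Y p)) =ᶠ[𝓝 (ψ q)]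
      fun x ↦ fderiv ℝ (coordField ψ Z) x (coordField ψ Y x) := by
  have hsymm := ψ.tendsto_symm hq
  filter_upwards [ψ.open_target.mem_nhds (ψ.map_source hq),
    hsymm.eventually (eventually_mdifferentiableAt_section hZ)] with x hx hZx
  refine (hψ.velocity_apply _ (ψ.map_target hx) Z hZx _).trans ?_
  rw [ψ.right_inv hx, coordField]

end FlatCharts

section FlatConnections

variable {m : ℕ} {Q : Type*} [TopologicalSpace Q] [ChartedSpace (EuclideanSpace ℝ (Fin (m + 1))) Q]
  {φ ψ : OpenPartialHomeomorph Q (CoordSpace m)} {q : Q}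
  [IsManifold (𝓡 (m + 1)) ∞ Q] {K : LinearConnection m Q}
  {X Y Z : ∀ p : Q, TangentSpace (𝓡 (m + 1)) p}

theorem contMDiffAt_endomorphism_of_velocity
    {A : ∀ p : Q, TangentSpace (𝓡 (m + 1)) p →L[ℝ] TangentSpace (𝓡 (m + 1)) p}
    {B : Q → CoordSpace m →L[ℝ] CoordSpace m}
    (hφ : φ ∈ IsManifold.maximalAtlas (𝓡 (m + 1)) ∞ Q) (hqφ : q ∈ φ.source)
    (hB : ContMDiffAt (𝓡 (m + 1)) 𝓘(ℝ, CoordSpace m →L[ℝ] CoordSpace m) ∞ B q)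
    (hAB : ∀ᶠ p in 𝓝 q, ∀ v, velocity φ p (A p v) = B p (velocity φ p v)) :
    ContMDiffAt (𝓡 (m + 1)) ((𝓡 (m + 1)).prod 𝓘(ℝ, CoordSpace m →L[ℝ] CoordSpace m)) ∞
      (fun p ↦ (⟨p, A p⟩ : Bundle.TotalSpace (CoordSpace m →L[ℝ] CoordSpace m)
        fun p : Q ↦ TangentSpace (𝓡 (m + 1)) p →L[ℝ] TangentSpace (𝓡 (m + 1)) p)) q := by
  rw [contMDiffAt_hom_bundle]
  refine ⟨contMDiffAt_id, ?_⟩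
  set χ := chartAt (CoordSpace m) q
  have hχ : χ ∈ IsManifold.maximalAtlas (𝓡 (m + 1)) ∞ Q := IsManifold.chart_mem_maximalAtlas q
  have hqχ : q ∈ χ.source := mem_chart_source _ q
  refine ((contMDiffAt_fderiv_transition hφ hχ hqφ hqχ).clm_comp
    (hB.clm_comp (contMDiffAt_fderiv_transition hχ hφ hqχ hqφ))).congr_of_eventuallyEq ?_
  filter_upwards [φ.open_source.mem_nhds hqφ, χ.open_source.mem_nhds hqχ, hAB] with p hpφ hpχ hABp
  ext1 u
  set e := trivializationAt (CoordSpace m) (TangentSpace (𝓡 (m + 1))) q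
  have he (v : TangentSpace (𝓡 (m + 1)) p) : e.continuousLinearMapAt ℝ p v = velocity χ p v := by
    rw [TangentBundle.continuousLinearMapAt_trivializationAt hpχ]
    rfl
  have hu : velocity χ p (e.symmL ℝ p u) = u := by
    rw [← he]
    exact Bundle.Trivialization.continuousLinearMapAt_symmL _ (by simpa [e] using hpχ) u
  change e.continuousLinearMapAt ℝ p (A p (e.symmL ℝ p u)) = fderiv ℝ (transition φ χ) (φ p)
    (B p (fderiv ℝ (transition χ φ) (χ p) u))
  rw [he, velocity_eq_fderiv_transition hφ hχ hpφ hpχ, hABp,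
    velocity_eq_fderiv_transition hχ hφ hpχ hpφ, hu]

theorem LinearConnection.IsFlatChart.contMDiffAt (hψ : K.IsFlatChart ψ) (hq : q ∈ ψ.source)
    (hZ : ContMDiffAt (𝓡 (m + 1)) (𝓡 (m + 1)).tangent ∞ (T% Z) q) :
    ContMDiffAt (𝓡 (m + 1)) ((𝓡 (m + 1)).prod 𝓘(ℝ, CoordSpace m →L[ℝ] CoordSpace m)) ∞
      (fun p ↦ (⟨p, K Z p⟩ : Bundle.TotalSpace (CoordSpace m →L[ℝ] CoordSpace m)
        fun p : Q ↦ TangentSpace (𝓡 (m + 1)) p →L[ℝ] TangentSpace (𝓡 (m + 1)) p)) q := by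
  refine contMDiffAt_endomorphism_of_velocity (B := fun p ↦ fderiv ℝ (coordField ψ Z) (ψ p))
    hψ.mem_maximalAtlas hq ?_ ?_
  · exact ((contDiffAt_coordField hψ.mem_maximalAtlas hq hZ).fderiv_right (m := ∞)
      (by simp)).contMDiffAt.comp q (contMDiffAt_of_mem_maximalAtlas hψ.mem_maximalAtlas hq)
  · filter_upwards [ψ.open_source.mem_nhds hq, eventually_mdifferentiableAt_section hZ]
      with p hp hZp
    exact hψ.velocity_apply p hp Z hZp

theorem LinearConnection.IsFlatChart.velocity_apply_apply (hψ : K.IsFlatChart ψ)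
    (hq : q ∈ ψ.source) (hY : ContMDiffAt (𝓡 (m + 1)) (𝓡 (m + 1)).tangent ∞ (T% Y) q)
    (hZ : ContMDiffAt (𝓡 (m + 1)) (𝓡 (m + 1)).tangent ∞ (T% Z) q)
    (v : TangentSpace (𝓡 (m + 1)) q) :
    velocity ψ q (K (fun p ↦ K Z p (Y p)) q v) =
      fderiv ℝ (fun x ↦ fderiv ℝ (coordField ψ Z) x (coordField ψ Y x)) (ψ q)
        (velocity ψ q v) := by
  have hKZY : ContMDiffAt (𝓡 (m + 1)) (𝓡 (m + 1)).tangent ∞ (T% (fun p ↦ K Z p (Y p))) q :=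
    ContMDiffAt.clm_bundle_apply (hψ.contMDiffAt hq hZ) hY
  rw [hψ.velocity_apply q hq _ (hKZY.mdifferentiableAt (by simp)),
    (hψ.coordField_apply_eventuallyEq hq hZ).fderiv_eq]

theorem LinearConnection.IsLocallyFlat.contMDiffCovariantDerivative (hK : K.IsLocallyFlat) :
    CovariantDerivative.ContMDiffCovariantDerivative K ∞ := by
  refine ⟨⟨fun hσ q _ ↦ ?_⟩⟩
  obtain ⟨ψ, hψ, hq⟩ := hK q
  exact (hψ.contMDiffAt hq ((hσ.of_le (by simp)).contMDiffAt Filter.univ_mem)).contMDiffWithinAt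

theorem LinearConnection.IsLocallyFlat.torsion_eq_zero (hK : K.IsLocallyFlat) :
    K.torsion = 0 := by
  rw [CovariantDerivative.torsion_eq_zero_iff]
  intro X Y q hX hY
  obtain ⟨ψ, hψ, hq⟩ := hK q
  refine velocity_injective hψ.mem_maximalAtlas hq ?_
  rw [velocity_mlieBracket hψ.mem_maximalAtlas hq hX hY,
    ← velocityEquiv_apply hψ.mem_maximalAtlas hq, map_sub, velocityEquiv_apply,
    velocityEquiv_apply, hψ.velocity_apply q hq Y hY, hψ.velocity_apply q hq X hX,
    VectorField.lieBracket, coordField_apply hq, coordField_apply hq]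

theorem LinearConnection.IsLocallyFlat.isCurvatureFree (hK : K.IsLocallyFlat) :
    K.IsCurvatureFree := by
  intro q X Y Z hX hY hZ
  obtain ⟨ψ, hψ, hq⟩ := hK q
  have hψm := hψ.mem_maximalAtlas
  have hXd := hX.mdifferentiableAt (by simp)
  have hYd := hY.mdifferentiableAt (by simp)
  have hcoord {W : ∀ p : Q, TangentSpace (𝓡 (m + 1)) p}
      (hW : ContMDiffAt (𝓡 (m + 1)) (𝓡 (m + 1)).tangent ∞ (T% W) q) :=
    contDiffAt_coordField hψm hq hW
  refine (velocityEquiv hψm hq).injective ?_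
  rw [LinearConnection.curvature, map_sub, map_sub, map_zero]
  simp only [velocityEquiv_apply]
  rw [hψ.velocity_apply_apply hq hY hZ, hψ.velocity_apply_apply hq hX hZ,
    hψ.velocity_apply q hq Z (hZ.mdifferentiableAt (by simp)), velocity_mlieBracket hψm hq hXd hYd,
    VectorField.fderiv_apply_lieBracket (hcoord hZ) (by simp; norm_cast)
      ((hcoord hY).differentiableAt (by simp)) ((hcoord hX).differentiableAt (by simp)),
    coordField_apply hq, coordField_apply hq, sub_self]

end FlatConnections

section AffineAtlases

variable {m : ℕ} {Q : Type*} [TopologicalSpace Q] [ChartedSpace (EuclideanSpace ℝ (Fin (m + 1))) Q]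
  {ψ : OpenPartialHomeomorph Q (CoordSpace m)} {σ σ' : ∀ p : Q, TangentSpace (𝓡 (m + 1)) p} {q : Q}

/-- An atlas of smooth charts all of whose coordinate changes are (locally) affine. -/
structure IsAffineAtlas (𝒜 : Set (OpenPartialHomeomorph Q (CoordSpace m))) : Prop where
  mem_maximalAtlas : ∀ ψ ∈ 𝒜, ψ ∈ IsManifold.maximalAtlas (𝓡 (m + 1)) ∞ Q
  exists_mem_source : ∀ q : Q, ∃ ψ ∈ 𝒜, q ∈ ψ.source
  sndFDeriv_transition : ∀ ψ ∈ 𝒜, ∀ ψ' ∈ 𝒜, ∀ q ∈ ψ.source, q ∈ ψ'.source →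
    fderiv ℝ (fderiv ℝ (transition ψ ψ')) (ψ q) = 0

/-- The covariant derivative on the domain of `ψ` which is the ordinary derivative of the components
of vector fields in the coordinates `ψ`. -/
def chartDerivative (ψ : OpenPartialHomeomorph Q (CoordSpace m))
    (Z : ∀ p : Q, TangentSpace (𝓡 (m + 1)) p) (q : Q) :
    TangentSpace (𝓡 (m + 1)) q →L[ℝ] TangentSpace (𝓡 (m + 1)) q :=
  (mfderiv (𝓡 (m + 1)) (𝓡 (m + 1)) ψ q).inverse ∘L fderiv ℝ (coordField ψ Z) (ψ q) ∘L
    mfderiv (𝓡 (m + 1)) (𝓡 (m + 1)) ψ q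

theorem velocity_chartDerivative (hψ : ψ ∈ IsManifold.maximalAtlas (𝓡 (m + 1)) ∞ Q)
    (hq : q ∈ ψ.source) (v : TangentSpace (𝓡 (m + 1)) q) :
    velocity ψ q (chartDerivative ψ σ q v) =
      fderiv ℝ (coordField ψ σ) (ψ q) (velocity ψ q v) :=
  ContinuousLinearMap.IsInvertible.self_apply_inverse
    (f := mfderiv (𝓡 (m + 1)) (𝓡 (m + 1)) ψ q) ⟨velocityEquiv hψ hq, rfl⟩ _

theorem coordField_add : coordField ψ (σ + σ') = coordField ψ σ + coordField ψ σ' :=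
  funext fun x ↦ map_add (mfderiv (𝓡 (m + 1)) (𝓡 (m + 1)) ψ (ψ.symm x)) _ _

theorem coordField_smul (g : Q → ℝ) : coordField ψ (g • σ) = (g ∘ ψ.symm) • coordField ψ σ :=
  funext fun x ↦ map_smul (mfderiv (𝓡 (m + 1)) (𝓡 (m + 1)) ψ (ψ.symm x)) _ _

variable [IsManifold (𝓡 (m + 1)) ∞ Q]

theorem isCovariantDerivativeOn_chartDerivative
    (hψ : ψ ∈ IsManifold.maximalAtlas (𝓡 (m + 1)) ∞ Q) :
    IsCovariantDerivativeOn (CoordSpace m) (chartDerivative ψ) ψ.source where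
  add {σ σ' q} hσ hσ' hq := by
    ext1 v
    refine (velocityEquiv hψ hq).injective ?_
    rw [add_apply, map_add]
    simp only [velocityEquiv_apply, velocity_chartDerivative hψ hq]
    rw [coordField_add, fderiv_add (differentiableAt_coordField hψ hq hσ)
      (differentiableAt_coordField hψ hq hσ'), add_apply]
  leibniz {σ g q} hσ hg hq := by
    ext1 v
    refine (velocityEquiv hψ hq).injective ?_
    rw [add_apply, smul_apply, ContinuousLinearMap.smulRight_apply, map_add, map_smul, map_smul]
    simp only [velocityEquiv_apply, velocity_chartDerivative hψ hq]
    rw [coordField_smul, fderiv_smul (differentiableAt_comp_symm hψ hq hg)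
      (differentiableAt_coordField hψ hq hσ), mvfderiv_apply_eq_fderiv_comp_symm hψ hq hg,
      coordField_apply hq, Function.comp_apply, ψ.left_inv hq]
    rfl

theorem IsAffineAtlas.exists_isFlatChart {𝒜 : Set (OpenPartialHomeomorph Q (CoordSpace m))}
    (h𝒜 : IsAffineAtlas 𝒜) : ∃ K : LinearConnection m Q, ∀ ψ ∈ 𝒜, K.IsFlatChart ψ := by
  choose χ hχ hqχ using h𝒜.exists_mem_source
  have hχm (q : Q) := h𝒜.mem_maximalAtlas (χ q) (hχ q)
  refine ⟨{
    toFun Z q := chartDerivative (χ q) Z q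
    isCovariantDerivativeOnUniv :=
      { add {_ _ q} hσ hσ' _ :=
          (isCovariantDerivativeOn_chartDerivative (hχm q)).add hσ hσ' (hqχ q)
        leibniz {_ _ q} hσ hg _ :=
          (isCovariantDerivativeOn_chartDerivative (hχm q)).leibniz hσ hg (hqχ q) } },
    fun ψ hψ ↦ ⟨h𝒜.mem_maximalAtlas ψ hψ, fun q hq Z hZ v ↦ ?_⟩⟩
  have hψm := h𝒜.mem_maximalAtlas ψ hψ
  calc velocity ψ q (chartDerivative (χ q) Z q v)
    _ = fderiv ℝ (transition (χ q) ψ) (χ q q)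
          (fderiv ℝ (coordField (χ q) Z) (χ q q) (velocity (χ q) q v)) := by
      rw [velocity_eq_fderiv_transition (hχm q) hψm (hqχ q) hq,
        velocity_chartDerivative (hχm q) (hqχ q)]
    _ = fderiv ℝ (coordField ψ Z) (ψ q) (velocity ψ q v) := by
      rw [fderiv_coordField_transition (hχm q) hψm (hqχ q) hq hZ,
        h𝒜.sndFDeriv_transition (χ q) (hχ q) ψ hψ q (hqχ q) hq]
      simp

end AffineAtlases

section Components

variable {m : ℕ} {Q : Type*} [TopologicalSpace Q] [ChartedSpace (EuclideanSpace ℝ (Fin (m + 1))) Q]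
  [IsManifold (𝓡 (m + 1)) ∞ Q] {φ ψ : OpenPartialHomeomorph Q (CoordSpace m)}
  {K : LinearConnection m Q} {q : Q}

/-- The components `K_l^μ_ν = -(∇_{∂_l} ∂_ν)^μ` of a linear connection in the coordinates `φ`, with
the sign convention of `LinearConnection.HasComponents`. -/
def LinearConnection.components (K : LinearConnection m Q)
    (φ : OpenPartialHomeomorph Q (CoordSpace m)) (l μ ν : Fin (m + 1)) (q : Q) : ℝ :=
  -velocity φ q (K (constField φ (EuclideanSpace.single ν 1)) q
    (constField φ (EuclideanSpace.single l 1) q)) μ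

theorem LinearConnection.IsFlatChart.components_eq (hψ : K.IsFlatChart ψ)
    (hφ : φ ∈ IsManifold.maximalAtlas (𝓡 (m + 1)) ∞ Q) (hqφ : q ∈ φ.source) (hqψ : q ∈ ψ.source)
    (l μ ν : Fin (m + 1)) : K.components φ l μ ν q =
      christoffel φ ψ q (EuclideanSpace.single l 1) (EuclideanSpace.single ν 1) μ := by
  rw [components, hψ.velocity_apply_eq_sub_christoffel hφ hqφ hqψ
    (mdifferentiableAt_constField hφ hqφ _), velocity_constField hφ hqφ,
    velocity_constField hφ hqφ, (eventually_coordField_constField hφ hqφ _).fderiv_eq]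
  simp

theorem LinearConnection.IsFlatChart.sum_components (hψ : K.IsFlatChart ψ)
    (hφ : φ ∈ IsManifold.maximalAtlas (𝓡 (m + 1)) ∞ Q) (hqφ : q ∈ φ.source) (hqψ : q ∈ ψ.source)
    (u w : CoordSpace m) (μ : Fin (m + 1)) :
    ∑ l, ∑ ν, K.components φ l μ ν q * u l * w ν = christoffel φ ψ q u w μ := by
  simp only [hψ.components_eq hφ hqφ hqψ, sum_christoffel_single]

namespace LinearConnection.IsLocallyFlat

theorem components_comm (hK : K.IsLocallyFlat)
    (hφ : φ ∈ IsManifold.maximalAtlas (𝓡 (m + 1)) ∞ Q) (hq : q ∈ φ.source)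
    (l μ ν : Fin (m + 1)) : K.components φ l μ ν q = K.components φ ν μ l q := by
  obtain ⟨ψ, hψ, hqψ⟩ := hK q
  rw [hψ.components_eq hφ hq hqψ, hψ.components_eq hφ hq hqψ,
    christoffel_comm hφ hψ.mem_maximalAtlas hq hqψ]

theorem contMDiffOn_components (hK : K.IsLocallyFlat)
    (hφ : φ ∈ IsManifold.maximalAtlas (𝓡 (m + 1)) ∞ Q) (l μ ν : Fin (m + 1)) :
    ContMDiffOn (𝓡 (m + 1)) 𝓘(ℝ, ℝ) ∞ (K.components φ l μ ν) φ.source := by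
  intro q hq
  obtain ⟨ψ, hψ, hqψ⟩ := hK q
  have hchristoffel := (EuclideanSpace.proj μ : CoordSpace m →L[ℝ] ℝ).contMDiff.contMDiffAt.comp q
    (contMDiffAt_christoffel hφ hψ.mem_maximalAtlas hq hqψ (EuclideanSpace.single l 1)
      (EuclideanSpace.single ν 1))
  refine (hchristoffel.congr_of_eventuallyEq ?_).contMDiffWithinAt
  filter_upwards [φ.open_source.mem_nhds hq, ψ.open_source.mem_nhds hqψ] with p hpφ hpψ
  exact hψ.components_eq hφ hpφ hpψ l μ ν

theorem hasComponents (hK : K.IsLocallyFlat)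
    (hφ : φ ∈ IsManifold.maximalAtlas (𝓡 (m + 1)) ∞ Q) :
    K.HasComponents φ (K.components φ) := by
  intro q hq Z hZ v μ
  obtain ⟨ψ, hψ, hqψ⟩ := hK q
  rw [hψ.sum_components hφ hq hqψ, hψ.velocity_apply_eq_sub_christoffel hφ hq hqψ hZ,
    PiLp.sub_apply, ← mvfderiv_velocity_coord_eq_fderiv_coordField hφ hq hZ]
  rfl

end LinearConnection.IsLocallyFlat

end Components

section DynamicEquations

variable {m : ℕ} {Q : Type*} [TopologicalSpace Q] [ChartedSpace (EuclideanSpace ℝ (Fin (m + 1))) Q]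
  {π : Q → ℝ} {φ ψ : OpenPartialHomeomorph Q (CoordSpace m)} {q : Q}

theorem IsBundleChart.velocity_time (hφ : IsBundleChart π φ) (hq : q ∈ φ.source)
    (v : TangentSpace (𝓡 (m + 1)) q) : velocity φ q v 0 = timeRate π ⟨q, v⟩ := by
  have htime : π =ᶠ[𝓝 q] fun p ↦ φ p 0 := by
    filter_upwards [φ.open_source.mem_nhds hq] with p hp
    exact (hφ.time_coord p hp).symm
  have hderiv := (EuclideanSpace.proj 0 : CoordSpace m →L[ℝ] ℝ).hasFDerivAt.hasMFDerivAt.comp q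
    ((mdifferentiable_of_mem_maximalAtlas hφ.mem_maximalAtlas).mdifferentiableAt hq).hasMFDerivAt
  exact congrArg (fun L : TangentSpace (𝓡 (m + 1)) q →L[ℝ] ℝ ↦ L v)
    (hderiv.congr_of_eventuallyEq htime).mfderiv.symm

theorem IsBundleChart.velocity_time_of_mem_jetOne (hφ : IsBundleChart π φ)
    {v : TangentBundle (𝓡 (m + 1)) Q} (hv : v ∈ jetOne π) (hvφ : v.proj ∈ φ.source) :
    velocity φ v.proj v.2 0 = 1 :=
  (hφ.velocity_time hvφ v.2).trans hv

theorem IsBundleChart.exists_mem_jetOne (hφ : IsBundleChart π φ) (hq : q ∈ φ.source)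
    {u : CoordSpace m} (hu : u 0 = 1) : ∃ v : TangentSpace (𝓡 (m + 1)) q,
      (⟨q, v⟩ : TangentBundle (𝓡 (m + 1)) Q) ∈ jetOne π ∧ velocity φ q v = u := by
  obtain ⟨v, rfl⟩ := velocity_surjective hφ.mem_maximalAtlas hq u
  exact ⟨v, (hφ.velocity_time hq v).symm.trans hu, rfl⟩

variable [IsManifold (𝓡 (m + 1)) ∞ Q] {ξ : DynamicEquation m π}

namespace DynamicEquation

/-- All fibre components `(0, ξ¹, …, ξᵐ)` of a dynamic equation in the coordinates `φ`: the
derivative of the velocity along the equation. -/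
def acceleration (ξ : DynamicEquation m π) (φ : OpenPartialHomeomorph Q (CoordSpace m))
    (v : TangentBundle (𝓡 (m + 1)) Q) : CoordSpace m :=
  mfderiv (𝓡 (m + 1)).tangent 𝓘(ℝ, CoordSpace m)
    (fun w : TangentBundle (𝓡 (m + 1)) Q ↦ velocity φ w.proj w.2) v (ξ.toFun v)

theorem acceleration_time (hφ : IsBundleChart π φ) {v : TangentBundle (𝓡 (m + 1)) Q}
    (hv : v ∈ jetOne π) (hvφ : v.proj ∈ φ.source) : ξ.acceleration φ v 0 = 0 := by
  have htime : timeRate π =ᶠ[𝓝 v]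
      fun w : TangentBundle (𝓡 (m + 1)) Q ↦ velocity φ w.proj w.2 0 := by
    filter_upwards [eventually_proj_mem_source hvφ] with w hw
    exact (hφ.velocity_time hw w.2).symm
  have hderiv := (EuclideanSpace.proj 0 : CoordSpace m →L[ℝ] ℝ).hasFDerivAt.hasMFDerivAt.comp v
    ((contMDiffAt_velocity hφ.mem_maximalAtlas hvφ).mdifferentiableAt (by simp)).hasMFDerivAt
  exact (congrArg (fun L : TangentSpace (𝓡 (m + 1)).tangent v →L[ℝ] ℝ ↦ L (ξ.toFun v))
    (hderiv.congr_of_eventuallyEq htime).mfderiv.symm).trans (ξ.tangent v hv)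

theorem acceleration_transition (hφ : φ ∈ IsManifold.maximalAtlas (𝓡 (m + 1)) ∞ Q)
    (hψ : ψ ∈ IsManifold.maximalAtlas (𝓡 (m + 1)) ∞ Q) {v : TangentBundle (𝓡 (m + 1)) Q}
    (hv : v ∈ jetOne π) (hvφ : v.proj ∈ φ.source) (hvψ : v.proj ∈ ψ.source) :
    ξ.acceleration ψ v = fderiv ℝ (transition φ ψ) (φ v.proj) (ξ.acceleration φ v) +
      fderiv ℝ (fderiv ℝ (transition φ ψ)) (φ v.proj)
        (velocity φ v.proj v.2) (velocity φ v.proj v.2) := by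
  have htransition := mvfderiv_velocity_transition (g := fun w ↦ w) hφ hψ mdifferentiableAt_id
    hvφ hvψ (ξ.toFun v)
  rw [ξ.holonomic v hv] at htransition
  exact htransition

/-- Bundle coordinates in which the dynamic equation reads `qⁱₜₜ = 0`. -/
structure IsFreeChart (ξ : DynamicEquation m π) (ψ : OpenPartialHomeomorph Q (CoordSpace m)) :
    Prop where
  isBundleChart : IsBundleChart π ψ
  acceleration_eq_zero : ∀ v ∈ jetOne π, v.proj ∈ ψ.source → ξ.acceleration ψ v = 0

/-- The dynamic equation reads `qⁱₜₜ = 0` in suitable bundle coordinates around every point; these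
need not be proper for a common reference frame. -/
def IsLocallyFree (ξ : DynamicEquation m π) : Prop :=
  ∀ q : Q, ∃ ψ : OpenPartialHomeomorph Q (CoordSpace m), ξ.IsFreeChart ψ ∧ q ∈ ψ.source

theorem IsFreeMotion.isLocallyFree (hξ : ξ.IsFreeMotion) : ξ.IsLocallyFree := by
  intro q
  obtain ⟨Γ, hΓ⟩ := hξ
  obtain ⟨ψ, hq, ⟨hψ, -⟩, hcomponent⟩ := hΓ q
  refine ⟨ψ, ⟨hψ, fun v hv hvψ ↦ ?_⟩, hq⟩
  ext μ
  exact Fin.cases (acceleration_time hψ hv hvψ) (hcomponent v hv hvψ) μ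

theorem IsFreeChart.sndFDeriv_transition (hψ : ξ.IsFreeChart ψ) {ψ'} (hψ' : ξ.IsFreeChart ψ')
    (hq : q ∈ ψ.source) (hq' : q ∈ ψ'.source) :
    fderiv ℝ (fderiv ℝ (transition ψ ψ')) (ψ q) = 0 := by
  have hψm := hψ.isBundleChart.mem_maximalAtlas
  have hψm' := hψ'.isBundleChart.mem_maximalAtlas
  have hzero := bilin_eq_zero_of_affineHyperplane
    (B := (fderiv ℝ (fderiv ℝ (transition ψ ψ')) (ψ q)).toLinearMap₁₂)
    (ℓ := (EuclideanSpace.proj (0 : Fin (m + 1)) : CoordSpace m →L[ℝ] ℝ).toLinearMap)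
    (e := EuclideanSpace.single 0 1) (sndFDeriv_transition_comm hψm hψm' hq hq') (by simp) ?_
  · ext1 u
    ext1 w
    exact congrArg (fun B ↦ B u w) hzero
  · intro u hu
    obtain ⟨v, hv, rfl⟩ := hψ.isBundleChart.exists_mem_jetOne hq hu
    have htransition := acceleration_transition (ξ := ξ) hψm hψm' hv hq hq'
    rw [hψ.acceleration_eq_zero _ hv hq, hψ'.acceleration_eq_zero _ hv hq', map_zero,
      zero_add] at htransition
    exact htransition.symm

theorem IsLocallyFree.isAffineAtlas (hξ : ξ.IsLocallyFree) :
    IsAffineAtlas {ψ | ξ.IsFreeChart ψ} where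
  mem_maximalAtlas _ hψ := hψ.isBundleChart.mem_maximalAtlas
  exists_mem_source := hξ
  sndFDeriv_transition _ hψ _ hψ' _ hq hq' := hψ.sndFDeriv_transition hψ' hq hq'

theorem IsFreeChart.acceleration_eq_christoffel (hψ : ξ.IsFreeChart ψ)
    (hφ : φ ∈ IsManifold.maximalAtlas (𝓡 (m + 1)) ∞ Q) {v : TangentBundle (𝓡 (m + 1)) Q}
    (hv : v ∈ jetOne π) (hvφ : v.proj ∈ φ.source) (hvψ : v.proj ∈ ψ.source) :
    ξ.acceleration φ v =
      christoffel φ ψ v.proj (velocity φ v.proj v.2) (velocity φ v.proj v.2) := by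
  have hψm := hψ.isBundleChart.mem_maximalAtlas
  have htransition := congrArg (fderiv ℝ (transition ψ φ) (ψ v.proj))
    (acceleration_transition (ξ := ξ) hφ hψm hv hvφ hvψ)
  rw [hψ.acceleration_eq_zero v hv hvψ, map_zero, map_add,
    fderiv_transition_fderiv_transition hφ hψm hvφ hvψ] at htransition
  exact eq_neg_of_add_eq_zero_left htransition.symm

end DynamicEquation

end DynamicEquations

section QuadraticEquations

variable {m : ℕ} {Q : Type*} {a : Fin m → Fin m → Fin m → Q → ℝ} {b : Fin m → Fin m → Q → ℝ}
  {f : Fin m → Q → ℝ} {q : Q}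

theorem quadraticComponents_comm (ha : ∀ i j k, a i j k q = a i k j q) (l μ ν : Fin (m + 1)) :
    quadraticComponents a b f l μ ν q = quadraticComponents a b f ν μ l q := by
  cases μ using Fin.cases with
  | zero => rfl
  | succ i =>
    cases l using Fin.cases <;> cases ν using Fin.cases <;>
      simp only [quadraticComponents, Fin.cases_zero, Fin.cases_succ]
    exact ha i _ _

theorem sum_quadraticComponents {u : Fin (m + 1) → ℝ} (hu : u 0 = 1) (i : Fin m) :
    ∑ l, ∑ ν, quadraticComponents a b f l i.succ ν q * u l * u ν =
      (∑ j, ∑ k, a i j k q * u j.succ * u k.succ) + (∑ j, b i j q * u j.succ) + f i q := by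
  simp only [Fin.sum_univ_succ, quadraticComponents, Fin.cases_zero, Fin.cases_succ, hu, mul_one,
    Finset.sum_add_distrib]
  have hhalf : ∑ j, b i j q * u j.succ =
      ∑ j, 1 / 2 * b i j q * u j.succ + ∑ j, 1 / 2 * b i j q * u j.succ := by
    rw [← Finset.sum_add_distrib]
    exact Finset.sum_congr rfl fun _ _ ↦ by ring
  rw [hhalf]
  ring

variable [TopologicalSpace Q] [ChartedSpace (EuclideanSpace ℝ (Fin (m + 1))) Q]
  [IsManifold (𝓡 (m + 1)) ∞ Q] {π : Q → ℝ} {φ : OpenPartialHomeomorph Q (CoordSpace m)}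
  {ξ : DynamicEquation m π} {K K' : LinearConnection m Q}

theorem DynamicEquation.HasQuadraticForm.component_eq_sum (h : ξ.HasQuadraticForm φ a b f)
    (hφ : IsBundleChart π φ) {v : TangentBundle (𝓡 (m + 1)) Q} (hv : v ∈ jetOne π)
    (hvφ : v.proj ∈ φ.source) (i : Fin m) :
    ξ.component φ v i = ∑ l, ∑ ν, quadraticComponents a b f l i.succ ν v.proj *
      velocity φ v.proj v.2 l * velocity φ v.proj v.2 ν := by
  rw [sum_quadraticComponents (hφ.velocity_time_of_mem_jetOne hv hvφ), h.component_eq v hv hvφ]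

theorem DynamicEquation.exists_hasQuadraticForm (hφ : IsBundleChart π φ)
    {k : Fin (m + 1) → Fin (m + 1) → Fin (m + 1) → Q → ℝ}
    (hsmooth : ∀ l μ ν, ContMDiffOn (𝓡 (m + 1)) 𝓘(ℝ, ℝ) ∞ (k l μ ν) φ.source)
    (hcomm : ∀ q ∈ φ.source, ∀ l μ ν, k l μ ν q = k ν μ l q)
    (htime : ∀ q ∈ φ.source, ∀ l ν, k l 0 ν q = 0)
    (hcomponent : ∀ v ∈ jetOne π, v.proj ∈ φ.source → ∀ i, ξ.component φ v i =
      ∑ l, ∑ ν, k l i.succ ν v.proj * velocity φ v.proj v.2 l * velocity φ v.proj v.2 ν) :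
    ∃ a b f, ξ.HasQuadraticForm φ a b f ∧
      ∀ q ∈ φ.source, ∀ l μ ν, quadraticComponents a b f l μ ν q = k l μ ν q := by
  let a : Fin m → Fin m → Fin m → Q → ℝ := fun i j n ↦ k j.succ i.succ n.succ
  let b : Fin m → Fin m → Q → ℝ := fun i j p ↦ 2 * k 0 i.succ j.succ p
  let f : Fin m → Q → ℝ := fun i ↦ k 0 i.succ 0
  have hk (q) (hq : q ∈ φ.source) (l μ ν) : quadraticComponents a b f l μ ν q = k l μ ν q := by
    have hhalf (x : ℝ) : 1 / 2 * (2 * x) = x := by ring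
    cases μ using Fin.cases with
    | zero => exact (htime q hq l ν).symm
    | succ i =>
      cases l using Fin.cases <;> cases ν using Fin.cases <;>
        simp only [quadraticComponents, Fin.cases_zero, Fin.cases_succ, a, b, f, hhalf]
      exact hcomm q hq _ _ _
  refine ⟨a, b, f, ⟨fun i j n q hq ↦ hcomm q hq _ _ _, fun i j n ↦ hsmooth _ _ _,
    fun i j ↦ contMDiffOn_const.mul (hsmooth _ _ _), fun i ↦ hsmooth _ _ _,
    fun v hv hvφ i ↦ ?_⟩, hk⟩
  rw [hcomponent v hv hvφ, ← sum_quadraticComponents (hφ.velocity_time_of_mem_jetOne hv hvφ)]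
  simp only [hk v.proj hvφ]

namespace LinearConnection

theorem HasComponents.congr {k k' : Fin (m + 1) → Fin (m + 1) → Fin (m + 1) → Q → ℝ}
    (h : K.HasComponents φ k) (hk : ∀ q ∈ φ.source, ∀ l μ ν, k' l μ ν q = k l μ ν q) :
    K.HasComponents φ k' := by
  intro q hq Z hZ v μ
  simp only [hk q hq]
  exact h q hq Z hZ v μ

theorem CorrespondsTo.isQuadratic (hK : K.CorrespondsTo ξ) : ξ.IsQuadratic := fun φ hφ ↦
  let ⟨a, b, f, hquadratic, _⟩ := hK φ hφ
  ⟨a, b, f, hquadratic⟩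

theorem CorrespondsTo.sameAs
    (hπ : ∀ q : Q, ∃ φ : OpenPartialHomeomorph Q (CoordSpace m), IsBundleChart π φ ∧ q ∈ φ.source)
    (hK : K.CorrespondsTo ξ) (hK' : K'.CorrespondsTo ξ) : K.SameAs K' := by
  intro q Z hZ
  obtain ⟨φ, hφ, hq⟩ := hπ q
  obtain ⟨a, b, f, hquadratic, hcomponents⟩ := hK φ hφ
  obtain ⟨a', b', f', hquadratic', hcomponents'⟩ := hK' φ hφ
  have hcoefficients (l μ ν : Fin (m + 1)) :
      quadraticComponents a b f l μ ν q = quadraticComponents a' b' f' l μ ν q := by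
    cases μ using Fin.cases with
    | zero => rfl
    | succ i =>
      refine congrFun₂ (matrix_eq_of_affineHyperplane (i₀ := 0)
        (A := fun l ν ↦ quadraticComponents a b f l i.succ ν q)
        (A' := fun l ν ↦ quadraticComponents a' b' f' l i.succ ν q)
        (Matrix.IsSymm.ext fun _ _ ↦ quadraticComponents_comm (hquadratic.symm · · · q hq) _ _ _)
        (Matrix.IsSymm.ext fun _ _ ↦ quadraticComponents_comm (hquadratic'.symm · · · q hq) _ _ _)
        fun u hu ↦ ?_) l ν
      obtain ⟨v, hv, hvu⟩ := hφ.exists_mem_jetOne hq (u := WithLp.toLp 2 u) hu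
      have hcomponent := hquadratic.component_eq_sum hφ hv hq i
      rw [hquadratic'.component_eq_sum hφ hv hq i, hvu] at hcomponent
      exact hcomponent.symm
  ext1 v
  refine velocity_injective hφ.mem_maximalAtlas hq ?_
  ext μ
  rw [hcomponents q hq Z hZ, hcomponents' q hq Z hZ]
  simp only [hcoefficients]

theorem acceleration_apply_eq_sum_components (hξ : ξ.IsLocallyFree)
    (hK : ∀ ψ, ξ.IsFreeChart ψ → K.IsFlatChart ψ)
    (hφ : φ ∈ IsManifold.maximalAtlas (𝓡 (m + 1)) ∞ Q) {v : TangentBundle (𝓡 (m + 1)) Q}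
    (hv : v ∈ jetOne π) (hvφ : v.proj ∈ φ.source) (μ : Fin (m + 1)) :
    ξ.acceleration φ v μ = ∑ l, ∑ ν, K.components φ l μ ν v.proj *
      velocity φ v.proj v.2 l * velocity φ v.proj v.2 ν := by
  obtain ⟨ψ, hψ, hvψ⟩ := hξ v.proj
  rw [hψ.acceleration_eq_christoffel hφ hv hvφ hvψ, (hK ψ hψ).sum_components hφ hvφ hvψ]

theorem isLocallyFlat_of_isFreeChart (hξ : ξ.IsLocallyFree)
    (hK : ∀ ψ, ξ.IsFreeChart ψ → K.IsFlatChart ψ) : K.IsLocallyFlat := fun q ↦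
  let ⟨ψ, hψ, hq⟩ := hξ q
  ⟨ψ, hK ψ hψ, hq⟩

theorem components_time (hξ : ξ.IsLocallyFree) (hK : ∀ ψ, ξ.IsFreeChart ψ → K.IsFlatChart ψ)
    (hφ : IsBundleChart π φ) (hq : q ∈ φ.source) (l ν : Fin (m + 1)) :
    K.components φ l 0 ν q = 0 := by
  have hflat := isLocallyFlat_of_isFreeChart hξ hK
  refine congrFun₂ (matrix_eq_of_affineHyperplane (i₀ := 0)
    (A := fun l ν ↦ K.components φ l 0 ν q) (A' := 0)
    (Matrix.IsSymm.ext fun _ _ ↦ hflat.components_comm hφ.mem_maximalAtlas hq _ _ _)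
    Matrix.isSymm_zero fun u hu ↦ ?_) l ν
  obtain ⟨v, hv, hvu⟩ := hφ.exists_mem_jetOne hq (u := WithLp.toLp 2 u) hu
  have hacceleration :=
    acceleration_apply_eq_sum_components hξ hK hφ.mem_maximalAtlas hv hq 0
  rw [DynamicEquation.acceleration_time hφ hv hq, hvu] at hacceleration
  simpa only [Matrix.zero_apply, zero_mul, Finset.sum_const_zero] using hacceleration.symm

theorem correspondsTo_of_isFreeChart (hξ : ξ.IsLocallyFree)
    (hK : ∀ ψ, ξ.IsFreeChart ψ → K.IsFlatChart ψ) : K.CorrespondsTo ξ := by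
  intro φ hφ
  have hflat := isLocallyFlat_of_isFreeChart hξ hK
  have hφm := hφ.mem_maximalAtlas
  obtain ⟨a, b, f, hquadratic, hk⟩ := DynamicEquation.exists_hasQuadraticForm (ξ := ξ) hφ
    (hflat.contMDiffOn_components hφm) (fun q hq ↦ hflat.components_comm hφm hq)
    (fun q hq ↦ components_time hξ hK hφ hq)
    (fun v hv hvφ i ↦ acceleration_apply_eq_sum_components hξ hK hφm hv hvφ i.succ)
  exact ⟨a, b, f, hquadratic, (hflat.hasComponents hφm).congr hk⟩

end LinearConnection

end QuadraticEquations

end TimeMechanics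

end

theorem proposition6p2_general {m : ℕ}
    {Q : Type*} [TopologicalSpace Q]
    [ChartedSpace (EuclideanSpace ℝ (Fin (m + 1))) Q] [IsManifold (𝓡 (m + 1)) ∞ Q]
    {π : Q → ℝ} (ξ : TimeMechanics.DynamicEquation m π) (hξ : ξ.IsLocallyFree) :
    ξ.IsQuadratic ∧
    ∃ K : TimeMechanics.LinearConnection m Q,
      CovariantDerivative.ContMDiffCovariantDerivative K ∞ ∧
      K.CorrespondsTo ξ ∧
      (∀ K' : TimeMechanics.LinearConnection m Q, K'.CorrespondsTo ξ → K'.SameAs K) ∧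
      K.torsion = 0 ∧
      K.IsCurvatureFree := by
  obtain ⟨K, hK⟩ := hξ.isAffineAtlas.exists_isFlatChart
  have hflat := TimeMechanics.LinearConnection.isLocallyFlat_of_isFreeChart hξ hK
  have hcorr := TimeMechanics.LinearConnection.correspondsTo_of_isFreeChart hξ hK
  have hcover (q : Q) : ∃ φ : OpenPartialHomeomorph Q (EuclideanSpace ℝ (Fin (m + 1))),
      TimeMechanics.IsBundleChart π φ ∧ q ∈ φ.source :=
    let ⟨ψ, hψ, hq⟩ := hξ q
    ⟨ψ, hψ.isBundleChart, hq⟩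
  exact ⟨hcorr.isQuadratic, K, hflat.contMDiffCovariantDerivative, hcorr,
    fun K' hK' ↦ hK'.sameAs hcover hcorr, hflat.torsion_eq_zero, hflat.isCurvatureFree⟩

theorem proposition6p2 {m : ℕ}
    {M : Type*} [TopologicalSpace M] [T2Space M] [SecondCountableTopology M]
    [ChartedSpace (EuclideanSpace ℝ (Fin m)) M] [IsManifold (𝓡 m) ∞ M]
    {Q : Type*} [TopologicalSpace Q] [T2Space Q] [SecondCountableTopology Q]
    [ChartedSpace (EuclideanSpace ℝ (Fin (m + 1))) Q] [IsManifold (𝓡 (m + 1)) ∞ Q]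
    (π : Q → ℝ) (hπ : TimeMechanics.IsSmoothFibreBundle m M π)
    (ξ : TimeMechanics.DynamicEquation m π) (hξ : ξ.IsFreeMotion) :
    ξ.IsQuadratic ∧
    ∃ K : TimeMechanics.LinearConnection m Q,
      CovariantDerivative.ContMDiffCovariantDerivative K ∞ ∧
      K.CorrespondsTo ξ ∧
      (∀ K' : TimeMechanics.LinearConnection m Q, K'.CorrespondsTo ξ → K'.SameAs K) ∧
      K.torsion = 0 ∧
      K.IsCurvatureFree :=
  proposition6p2_general ξ hξ.isLocallyFree
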